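/- Let $\mathbf N=\{0,1,2,\dots\}$. An ideal on $\mathbf N$ is a family $\mathcal I\subsetneq\mathcal P(\mathbf N)$ that contains all finite sets and is closed under subsets and finite unions. It is a P-ideal if for every sequence $(B_n)$ in $\mathcal I$ there is $B\in\mathcal I$ with $B_n\setminus B$ finite for all $n$. It is called analytic, respectively $F_\sigma$, if it is so as a subset of the Cantor space $\{0,1\}^{\mathbf N}$, sets being identified with their characteristic functions. A lower semicontinuous submeasure is a map $\varphi:\mathcal P(\mathbf N)\to[0,\infty]$ such that $\varphi(\emptyset)=0$, $\varphi(A)\le\varphi(B)$ whenever $A\subseteq B$, $\varphi(A\cup B)\le\varphi(A)+\varphi(B)$, and $\varphi(A)=\lim_n\varphi(A\cap\{k: k<n\})$ for all $A,B\subseteq\mathbf N$. Put $\|A\|_\varphi:=\lim_n\varphi(A\setminus\{k:k<n\})$ and $\mathcal I_\varphi:=\{A\subseteq\mathbf N:\|A\|_\varphi=0\}$. For a sequence $x=(x_n)_{n\in\mathbf N}$ in a topological space $X$, let $\Lambda_x(\mathcal I)$ be the set of all $\ell\in X$ such that $\lim_k x_{n_k}=\ell$ for some strictly increasing sequence $(n_k)$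 with $\{n_k:k\in\mathbf N\}\notin\mathcal I$, and let $\Gamma_x(\mathcal I)$ be the set of all $\ell\in X$ such that $\{n:x_n\in U\}\notin\mathcal I$ for every neighborhood $U$ of $\ell$. **Theorem.** Let $X$ be a first countable Hausdorff space which admits a non-trivial convergent sequence, i.e. there are $\ell\in X$ and a sequence $(\ell_n)$ in $X$ converging to $\ell$ with $\ell_n\neq\ell$ for all $n$. Let $\varphi$ be a lower semicontinuous submeasure with $\varphi(\mathbf N)<\infty$ such that $\mathcal I_\varphi$ is an analytic P-ideal. Then the following are equivalent: 1. $\mathcal I_\varphi$ is an $F_\sigma$-ideal; 2. $\Lambda_x(\mathcal I_\varphi)=\Gamma_x(\mathcal I_\varphi)$ for all sequences $x$ in $X$; 3. $\Lambda_x(\mathcal I_\varphi)$ is closed for all sequences $x$ in $X$; 4. there does not exist a partition $\{A_n:n\in\mathbf N\}$ of $\mathbf N$ such that $\|A_n\|_\varphi>0$ for all $n$ and $\lim_n\bigl\|\bigcup_{k>n}A_k\bigr\|_\varphi=0$. -/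

import Mathlib

open Set Filter Topology
open scoped ENNReal

namespace IdealLimit

/-- An ideal on `ℕ`: a family of subsets closed under subsets and finite unions, containing all
finite sets and different from the whole power set. -/
structure IsIdeal (I : Set (Set ℕ)) : Prop where
  subset_mem : ∀ ⦃A B : Set ℕ⦄, A ⊆ B → B ∈ I → A ∈ I
  union_mem : ∀ ⦃A B : Set ℕ⦄, A ∈ I → B ∈ I → A ∪ B ∈ I
  finite_mem : ∀ ⦃A : Set ℕ⦄, A.Finite → A ∈ I
  univ_notMem : (univ : Set ℕ) ∉ I

/-- `I` is `σ`-directed modulo finite sets. -/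
def IsSigmaDirectedModFin (I : Set (Set ℕ)) : Prop :=
  ∀ A : ℕ → Set ℕ, (∀ n, A n ∈ I) → ∃ B ∈ I, ∀ n, (A n \ B).Finite

/-- A family of subsets of `ℕ`, seen in the Cantor space `ℕ → Bool` by identifying a set with its
characteristic function. -/
def inCantor (I : Set (Set ℕ)) : Set (ℕ → Bool) :=
  {f | {n | f n = true} ∈ I}

/-- An analytic P-ideal on `ℕ`. -/
structure IsAnalyticPIdeal (I : Set (Set ℕ)) : Prop where
  isIdeal : IsIdeal I
  analytic : MeasureTheory.AnalyticSet (inCantor I)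
  pIdeal : IsSigmaDirectedModFin I

/-- `F_σ` sets: countable unions of closed sets. -/
def IsFSigma {Y : Type*} [TopologicalSpace Y] (S : Set Y) : Prop :=
  ∃ F : ℕ → Set Y, (∀ n, IsClosed (F n)) ∧ S = ⋃ n, F n

/-- Lower semicontinuous submeasures on `ℕ`. Here `Iio n = {0, …, n - 1}`. -/
structure IsLSCSubmeasure (φ : Set ℕ → ℝ≥0∞) : Prop where
  empty : φ ∅ = 0
  mono : ∀ ⦃A B : Set ℕ⦄, A ⊆ B → φ A ≤ φ B
  union_le : ∀ A B : Set ℕ, φ (A ∪ B) ≤ φ A + φ B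
  lsc : ∀ A : Set ℕ, Tendsto (fun n : ℕ => φ (A ∩ Iio n)) atTop (𝓝 (φ A))

/-- `‖A‖_φ`, the limit of the decreasing sequence `φ (A \ {0, …, n - 1})`, written as an infimum. -/
noncomputable def subNorm (φ : Set ℕ → ℝ≥0∞) (A : Set ℕ) : ℝ≥0∞ :=
  ⨅ n : ℕ, φ (A \ Iio n)

theorem tendsto_subNorm {φ : Set ℕ → ℝ≥0∞} (hφ : IsLSCSubmeasure φ) (A : Set ℕ) :
    Tendsto (fun n : ℕ => φ (A \ Iio n)) atTop (𝓝 (subNorm φ A)) :=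
  tendsto_atTop_iInf fun _ _ h => hφ.mono (sdiff_subset_sdiff_right (Iio_subset_Iio h))

/-- The family `I_φ` of all sets `A` with `‖A‖_φ = 0`. -/
def idealOf (φ : Set ℕ → ℝ≥0∞) : Set (Set ℕ) :=
  {A | subNorm φ A = 0}

/-- The set `Λ_x(I)` of `I`-limit points of the sequence `x`. -/
def limitPoints {X : Type*} [TopologicalSpace X] (I : Set (Set ℕ)) (x : ℕ → X) : Set X :=
  {l | ∃ n : ℕ → ℕ, StrictMono n ∧ range n ∉ I ∧ Tendsto (fun k => x (n k)) atTop (𝓝 l)}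

/-- The set `Γ_x(I)` of `I`-cluster points of the sequence `x`. -/
def clusterPoints {X : Type*} [TopologicalSpace X] (I : Set (Set ℕ)) (x : ℕ → X) : Set X :=
  {l | ∀ U ∈ 𝓝 l, {n | x n ∈ U} ∉ I}

/-- `X` admits a non-trivial convergent sequence. -/
def HasNontrivialConvergentSeq (X : Type*) [TopologicalSpace X] : Prop :=
  ∃ (u : ℕ → X) (l : X), Tendsto u atTop (𝓝 l) ∧ ∀ n, u n ≠ l

/-- `A` is a partition of `ℕ` into infinitely many pieces of positive `φ`-norm whose tails have
`φ`-norm tending to zero. -/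
structure IsVanishingPartition (φ : Set ℕ → ℝ≥0∞) (A : ℕ → Set ℕ) : Prop where
  disjoint : ∀ m n, m ≠ n → Disjoint (A m) (A n)
  cover : ⋃ n, A n = univ
  pos : ∀ n, 0 < subNorm φ (A n)
  tail : Tendsto (fun n : ℕ => subNorm φ (⋃ k > n, A k)) atTop (𝓝 0)

end IdealLimit

namespace IdealLimit

/-! ### Norms of positive sets, vanishing partitions and the Borel class of the ideal. -/

section Submeasure

variable {φ : Set ℕ → ℝ≥0∞}

/-! The pivot is `HasNormGap`. Without a gap, positive sets of summable submeasure have tail unions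
whose norms decrease to zero, and successive differences of a thinned version form a vanishing
partition. With a gap, being small becomes a closed condition on some tail of the set, so the ideal
is `F_σ`; and positive finite blocks taken from shrinking neighbourhoods glue to a set converging to
a given cluster point. Conversely, a vanishing partition excludes `F_σ` by Baire category, and
labelling its pieces by a non-trivial convergent sequence gives a set of limit points that misses
the limit. -/

theorem IsLSCSubmeasure.iUnion_le (hφ : IsLSCSubmeasure φ) (B : ℕ → Set ℕ) :
    φ (⋃ k, B k) ≤ ∑' k, φ (B k) := by
  have hfinset : ∀ s : Finset ℕ, φ (⋃ k ∈ s, B k) ≤ ∑ k ∈ s, φ (B k) := by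
    intro s
    induction s using Finset.induction_on with
    | empty => simp [hφ.empty]
    | insert a s ha ih =>
      rw [Finset.set_biUnion_insert, Finset.sum_insert ha]
      exact (hφ.union_le _ _).trans (by gcongr)
  -- Lower semicontinuity reduces the bound to initial segments, each covered by finitely many `B
  -- k`.
  refine le_of_tendsto (hφ.lsc _) (Eventually.of_forall fun n => ?_)
  obtain ⟨t, ht, hsub⟩ := finite_subset_iUnion ((finite_Iio n).inter_of_right (⋃ k, B k))
    inter_subset_left
  calc φ ((⋃ k, B k) ∩ Iio n) ≤ φ (⋃ k ∈ ht.toFinset, B k) := hφ.mono (by simpa using hsub)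
    _ ≤ ∑ k ∈ ht.toFinset, φ (B k) := hfinset _
    _ ≤ ∑' k, φ (B k) := ENNReal.sum_le_tsum _

theorem subNorm_le (hφ : IsLSCSubmeasure φ) (A : Set ℕ) : subNorm φ A ≤ φ A :=
  (iInf_le _ 0).trans (hφ.mono sdiff_subset)

theorem subNorm_mono (hφ : IsLSCSubmeasure φ) {A B : Set ℕ} (h : A ⊆ B) :
    subNorm φ A ≤ subNorm φ B :=
  iInf_mono fun _ => hφ.mono (sdiff_subset_sdiff_left h)

theorem subNorm_union_le (hφ : IsLSCSubmeasure φ) (A B : Set ℕ) :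
    subNorm φ (A ∪ B) ≤ subNorm φ A + subNorm φ B := by
  refine le_of_tendsto_of_tendsto' (tendsto_subNorm hφ _)
    ((tendsto_subNorm hφ A).add (tendsto_subNorm hφ B)) fun n => ?_
  rw [union_sdiff_distrib]
  exact hφ.union_le _ _

theorem subNorm_of_finite (hφ : IsLSCSubmeasure φ) {A : Set ℕ} (hA : A.Finite) :
    subNorm φ A = 0 := by
  obtain ⟨n, hn⟩ := hA.bddAbove
  refine le_antisymm ((iInf_le _ (n + 1)).trans ?_) zero_le
  have hempty : A \ Iio (n + 1) = ∅ := sdiff_eq_empty.2 fun a ha => Nat.lt_succ_of_le (hn ha)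
  rw [hempty, hφ.empty]

theorem subNorm_le_of_finite_sdiff (hφ : IsLSCSubmeasure φ) {A B : Set ℕ}
    (h : (A \ B).Finite) : subNorm φ A ≤ subNorm φ B :=
  calc subNorm φ A ≤ subNorm φ (B ∪ A \ B) := subNorm_mono hφ (by simp)
    _ ≤ subNorm φ B + subNorm φ (A \ B) := subNorm_union_le hφ _ _
    _ = subNorm φ B := by rw [subNorm_of_finite hφ h, add_zero]

theorem subNorm_sdiff_Iio (hφ : IsLSCSubmeasure φ) (A : Set ℕ) (n : ℕ) :
    subNorm φ (A \ Iio n) = subNorm φ A :=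
  le_antisymm (subNorm_mono hφ sdiff_subset)
    (subNorm_le_of_finite_sdiff hφ ((finite_Iio n).subset (by simp)))

theorem mem_idealOf_of_finite (hφ : IsLSCSubmeasure φ) (A : Set ℕ) (hA : A.Finite) :
    A ∈ idealOf φ :=
  subNorm_of_finite hφ hA

/-- The `φ`-norms of the `φ`-positive sets are bounded away from zero. -/
def HasNormGap (φ : Set ℕ → ℝ≥0∞) : Prop :=
  ∃ δ : ℝ≥0∞, 0 < δ ∧ δ ≠ ∞ ∧ ∀ A, subNorm φ A < δ → subNorm φ A = 0

theorem isVanishingPartition_sdiff_succ (hφ : IsLSCSubmeasure φ) {E : ℕ → Set ℕ}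
    (hE : Antitone E) (h0 : E 0 = univ) (hinter : ∀ m, ∃ n, m ∉ E n)
    (hlt : ∀ n, subNorm φ (E (n + 1)) < subNorm φ (E n))
    (hlim : Tendsto (fun n => subNorm φ (E n)) atTop (𝓝 0)) :
    IsVanishingPartition φ fun n => E n \ E (n + 1) where
  disjoint := by
    have key : ∀ m n, m < n → Disjoint (E m \ E (m + 1)) (E n \ E (n + 1)) := fun m n h =>
      disjoint_left.2 fun _ ha hb => ha.2 (hE (Nat.succ_le_of_lt h) hb.1)
    intro m n h
    rcases h.lt_or_gt with h | h
    exacts [key m n h, (key n m h).symm]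
  cover := by
    classical
    refine eq_univ_of_forall fun m => ?_
    have hpos : Nat.find (hinter m) ≠ 0 := fun h => by
      have := Nat.find_spec (hinter m)
      rw [h, h0] at this
      exact this (mem_univ m)
    obtain ⟨k, hk⟩ := Nat.exists_eq_succ_of_ne_zero hpos
    refine mem_iUnion.2 ⟨k, ?_, ?_⟩
    · have := Nat.find_min (hinter m) (m := k) (by omega)
      exact not_not.1 this
    · have := Nat.find_spec (hinter m)
      rwa [hk] at this
  pos n := by
    refine pos_iff_ne_zero.2 fun h => (hlt n).not_ge ?_
    calc subNorm φ (E n) ≤ subNorm φ (E (n + 1) ∪ E n \ E (n + 1)) := subNorm_mono hφ (by simp)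
      _ ≤ _ := subNorm_union_le hφ _ _
      _ = _ := by rw [h, add_zero]
  tail := by
    refine tendsto_of_tendsto_of_tendsto_of_le_of_le tendsto_const_nhds hlim
      (fun _ => zero_le) fun n => subNorm_mono hφ ?_
    exact iUnion₂_subset fun k hk => sdiff_subset.trans (hE (le_of_lt hk))

/-- Positive sets of small norm can be trimmed and united into a decreasing sequence of positive
sets whose norms tend to zero. -/
theorem exists_antitone_of_not_hasNormGap (hφ : IsLSCSubmeasure φ) (h : ¬ HasNormGap φ) :
    ∃ C : ℕ → Set ℕ, Antitone C ∧ (∀ n, 0 < subNorm φ (C n)) ∧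
      Tendsto (fun n => subNorm φ (C n)) atTop (𝓝 0) := by
  obtain ⟨ε, hε, hsum⟩ := ENNReal.exists_pos_sum_of_countable' one_ne_zero ℕ
  have hB : ∀ n, ∃ B : Set ℕ, 0 < subNorm φ B ∧ φ B < ε n := by
    intro n
    by_contra! hcon
    refine h ⟨ε n, hε n, ne_top_of_le_ne_top (hsum.trans ENNReal.one_lt_top).ne
      (ENNReal.le_tsum n), fun A hA => ?_⟩
    by_contra hA0
    -- Cutting off an initial segment brings `φ` itself below `ε n` and leaves the norm unchanged.
    obtain ⟨k, hk⟩ := ((tendsto_subNorm hφ A).eventually_lt_const hA).exists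
    exact (hcon (A \ Iio k)
      (by rw [subNorm_sdiff_Iio hφ]; exact pos_iff_ne_zero.2 hA0)).not_gt hk
  choose B hBpos hBlt using hB
  refine ⟨fun n => ⋃ k, B (k + n), fun m n hmn => ?_, fun n => ?_, ?_⟩
  · refine iUnion_subset fun k => ?_
    have : B (k + n) = B (k + (n - m) + m) := by congr 1; omega
    rw [this]
    exact subset_iUnion (fun k => B (k + m)) _
  · exact (hBpos n).trans_le (subNorm_mono hφ (subset_iUnion_of_subset 0 (by simp)))
  · refine tendsto_of_tendsto_of_tendsto_of_le_of_le tendsto_const_nhds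
      (ENNReal.tendsto_sum_nat_add ε (hsum.trans ENNReal.one_lt_top).ne)
      (fun _ => zero_le) fun n => ?_
    exact (subNorm_le hφ _).trans ((hφ.iUnion_le _).trans
      (ENNReal.tsum_le_tsum fun k => (hBlt _).le))

theorem exists_isVanishingPartition (hφ : IsLSCSubmeasure φ) (h : ¬ HasNormGap φ) :
    ∃ A, IsVanishingPartition φ A := by
  obtain ⟨C, hC, hpos, hlim⟩ := exists_antitone_of_not_hasNormGap hφ h
  have hnext : ∀ n, ∃ m, n < m ∧ subNorm φ (C m) < subNorm φ (C n) := fun n =>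
    ((eventually_gt_atTop n).and (hlim.eventually_lt_const (hpos n))).exists
  choose g hg hglt using hnext
  let s : ℕ → ℕ := fun k => g^[k] 0
  have hs : ∀ k, s (k + 1) = g (s k) := fun k => Function.iterate_succ_apply' g k 0
  have hsmono : StrictMono s := strictMono_nat_of_lt_succ fun k => by rw [hs]; exact hg _
  -- Starting at `univ` and removing `Iio n` make the differences cover `ℕ`; neither costs any norm
  -- later on.
  let E : ℕ → Set ℕ := fun n => if n = 0 then univ else C (s n) \ Iio n
  have hE0 : E 0 = univ := if_pos rfl
  have hE : ∀ n, E (n + 1) = C (s (n + 1)) \ Iio (n + 1) := fun n => if_neg n.succ_ne_zero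
  have hnorm : ∀ n, subNorm φ (E (n + 1)) = subNorm φ (C (s (n + 1))) := fun n => by
    rw [hE, subNorm_sdiff_Iio hφ]
  refine ⟨_, isVanishingPartition_sdiff_succ hφ (E := E) ?_ hE0 ?_ ?_ ?_⟩
  · refine antitone_nat_of_succ_le fun n => ?_
    cases n with
    | zero => rw [hE0]; exact subset_univ _
    | succ n =>
      rw [hE, hE]
      exact sdiff_subset_sdiff (hC (hsmono.monotone (Nat.le_succ _)))
        (Iio_subset_Iio (Nat.le_succ _))
  · exact fun m => ⟨m + 1, by rw [hE]; exact fun hm => hm.2 (Nat.lt_succ_self m)⟩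
  · intro n
    rw [hnorm, hs]
    refine (hglt _).trans_le ?_
    cases n with
    | zero => rw [hE0]; exact subNorm_mono hφ (subset_univ _)
    | succ n => exact (hnorm n).ge
  · rw [← tendsto_add_atTop_iff_nat 1]
    simp only [hnorm]
    exact hlim.comp (hsmono.tendsto_atTop.comp (tendsto_add_atTop_nat 1))

/-- Such an `S` is contained, up to a finite set, in every tail of the partition, and the tail norms
tend to zero. -/
theorem IsVanishingPartition.subNorm_eq_zero (hφ : IsLSCSubmeasure φ) {A : ℕ → Set ℕ}
    (hA : IsVanishingPartition φ A) {S : Set ℕ} (hS : ∀ n, (S ∩ A n).Finite) :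
    subNorm φ S = 0 := by
  refine le_antisymm (ge_of_tendsto' hA.tail fun n => ?_) zero_le
  refine subNorm_le_of_finite_sdiff hφ
    (((finite_Iic n).biUnion fun k _ => hS k).subset fun m hm => ?_)
  obtain ⟨k, hk⟩ := mem_iUnion.1 (hA.cover.ge (mem_univ m))
  refine mem_iUnion₂.2 ⟨k, ?_, hm.1, hk⟩
  by_contra hkn
  exact hm.2 (mem_iUnion₂.2 ⟨k, not_le.1 hkn, hk⟩)

/-- A partition of `ℕ` is the family of fibres of a function. -/
theorem IsVanishingPartition.exists_index {A : ℕ → Set ℕ} (hA : IsVanishingPartition φ A) :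
    ∃ p : ℕ → ℕ, ∀ m n, m ∈ A n ↔ p m = n := by
  have : ∀ m, ∃ n, m ∈ A n := fun m => mem_iUnion.1 (hA.cover.ge (mem_univ m))
  choose p hp using this
  refine ⟨p, fun m n => ⟨fun h => ?_, fun h => h ▸ hp m⟩⟩
  by_contra hne
  exact disjoint_left.1 (hA.disjoint _ _ hne) (hp m) h

theorem HasNormGap.isFSigma (hφ : IsLSCSubmeasure φ) (h : HasNormGap φ) :
    IsFSigma (inCantor (idealOf φ)) := by
  obtain ⟨δ, hδ, hδtop, hgap⟩ := h
  have hlt : δ / 2 < δ := ENNReal.half_lt_self hδ.ne' hδtop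
  have hhalf : 0 < δ / 2 := ENNReal.half_pos hδ.ne'
  -- The bound `δ / 2` keeps the condition non-strict, hence closed, while still forcing a norm
  -- below `δ`.
  refine ⟨fun n => ⋂ k : ℕ, {f | φ (({m | f m = true} \ Iio n) ∩ Iio k) ≤ δ / 2},
    fun n => isClosed_iInter fun k => ?_, ?_⟩
  · -- membership depends only on the first `k` coordinates
    let r : (ℕ → Bool) → (Fin k → Bool) := fun f i => f i
    have hr : Continuous r := by fun_prop
    have : {f : ℕ → Bool | φ (({m | f m = true} \ Iio n) ∩ Iio k) ≤ δ / 2} =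
        r ⁻¹' {g | φ ({m | ∃ hm : m < k, g ⟨m, hm⟩ = true} \ Iio n) ≤ δ / 2} := by
      ext f
      have : ({m | f m = true} \ Iio n) ∩ Iio k =
          {m | ∃ hm : m < k, r f ⟨m, hm⟩ = true} \ Iio n := by
        ext m
        simp only [r, mem_inter_iff, Set.mem_sdiff, mem_ofPred_eq, mem_Iio, exists_prop]
        tauto
      simp only [mem_ofPred_eq, mem_preimage, this]
    rw [this]
    exact (isClosed_discrete _).preimage hr
  · ext f
    simp only [inCantor, idealOf, mem_ofPred_eq, mem_iUnion, mem_iInter]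
    constructor
    · intro hf
      obtain ⟨n, hn⟩ := ((tendsto_subNorm hφ {m | f m = true}).eventually_lt_const
        (hf.trans_lt hhalf)).exists
      exact ⟨n, fun k => (hφ.mono inter_subset_left).trans hn.le⟩
    · rintro ⟨n, hn⟩
      exact hgap _ (((iInf_le _ n).trans (le_of_tendsto' (hφ.lsc _) hn)).trans_lt hlt)

/-- Baire category argument on `ℕ → ℕ`: the sets meeting each piece of the partition in a bounded
set belong to the ideal, so a closed part of an `F_σ` ideal would contain a whole piece. -/
theorem not_isVanishingPartition_of_isFSigma (hφ : IsLSCSubmeasure φ)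
    (h : IsFSigma (inCantor (idealOf φ))) (A : ℕ → Set ℕ) : ¬ IsVanishingPartition φ A := by
  intro hA
  obtain ⟨F, hF, hFU⟩ := h
  obtain ⟨p, hp⟩ := hA.exists_index
  -- `S f` keeps from each piece `A k` the points below `f k`.
  let S : (ℕ → ℕ) → ℕ → Bool := fun f m => decide (m < f (p m))
  have hS : Continuous S := continuous_pi fun m =>
    (continuous_of_discreteTopology (f := fun j : ℕ => decide (m < j))).comp (continuous_apply _)
  have hcover : ⋃ n, S ⁻¹' F n = univ := by
    rw [← preimage_iUnion, ← hFU]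
    refine eq_univ_of_forall fun f => hA.subNorm_eq_zero hφ fun n => ?_
    refine (finite_Iio (f n)).subset fun m hm => ?_
    have h1 : m < f (p m) := of_decide_eq_true hm.1
    rwa [(hp m n).1 hm.2] at h1
  obtain ⟨n, f, hf⟩ := nonempty_interior_of_iUnion_of_closed (fun n => (hF n).preimage hS) hcover
  obtain ⟨I, u, hu, hIu⟩ := isOpen_pi_iff.1 isOpen_interior f hf
  -- A basic open set leaves some coordinate `k` free; letting it grow fills up all of `A k` without
  -- leaving the closed set `F n`.
  obtain ⟨k, hk⟩ := Infinite.exists_notMem_finset I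
  have hmem : ∀ j, S (Function.update f k j) ∈ F n := fun j => by
    refine interior_subset (s := S ⁻¹' F n) (hIu fun i hi => ?_)
    have hik : i ≠ k := fun e => hk (e ▸ hi)
    rw [Function.update_of_ne hik]
    exact (hu i hi).2
  let T : ℕ → Bool := fun m => if p m = k then true else S f m
  have hT : Tendsto (fun j => S (Function.update f k j)) atTop (𝓝 T) := by
    refine tendsto_pi_nhds.2 fun m => tendsto_const_nhds.congr' ?_
    filter_upwards [eventually_gt_atTop m] with j hj
    by_cases hm : p m = k
    · simp [S, T, hm, hj]
    · simp [S, T, hm]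
  have hTI : T ∈ inCantor (idealOf φ) := by
    rw [hFU]
    exact mem_iUnion.2 ⟨n, (hF n).mem_of_tendsto hT (Eventually.of_forall hmem)⟩
  refine (hA.pos k).not_ge ((subNorm_mono hφ fun m hm => ?_).trans (le_of_eq hTI))
  exact if_pos ((hp m k).1 hm)

end Submeasure

/-! ### Limit points and cluster points. -/

section Points

variable {X : Type*} [TopologicalSpace X] {I : Set (Set ℕ)} {x : ℕ → X}

theorem mem_limitPoints_iff (hI : ∀ A : Set ℕ, A.Finite → A ∈ I) {l : X} :
    l ∈ limitPoints I x ↔ ∃ S ∉ I, ∀ U ∈ 𝓝 l, (S ∩ {m | x m ∉ U}).Finite := by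
  constructor
  · rintro ⟨n, -, hnI, hlim⟩
    refine ⟨range n, hnI, fun U hU => ?_⟩
    have hfin : {k | x (n k) ∉ U}.Finite := by
      have := hlim.eventually hU
      rwa [← Nat.cofinite_eq_atTop, eventually_cofinite] at this
    refine (hfin.image n).subset ?_
    rintro _ ⟨⟨k, rfl⟩, hk⟩
    exact ⟨k, hk, rfl⟩
  · rintro ⟨S, hSI, hS⟩
    have hinf : S.Infinite := fun h => hSI (hI S h)
    have hmono : StrictMono (Nat.nth (· ∈ S)) := Nat.nth_strictMono hinf
    have hrange : range (Nat.nth (· ∈ S)) = S := Nat.range_nth_of_infinite hinf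
    refine ⟨_, hmono, by rwa [hrange], fun U hU => ?_⟩
    rw [← Nat.cofinite_eq_atTop]
    refine eventually_cofinite.2 (((hS U hU).preimage hmono.injective.injOn).subset fun k hk => ?_)
    exact ⟨hrange.le (mem_range_self k), hk⟩

theorem limitPoints_subset_clusterPoints (hI : IsIdeal I) :
    limitPoints I x ⊆ clusterPoints I x := by
  intro l hl U hU hmem
  obtain ⟨S, hSI, hS⟩ := (mem_limitPoints_iff hI.finite_mem).1 hl
  refine hSI (hI.subset_mem (fun m hm => ?_) (hI.union_mem hmem (hI.finite_mem (hS U hU))))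
  by_cases h : x m ∈ U
  exacts [Or.inl h, Or.inr ⟨hm, h⟩]

theorem isClosed_clusterPoints : IsClosed (clusterPoints I x) := by
  refine isClosed_of_closure_subset fun l hl U hU => ?_
  obtain ⟨V, hVU, hV, hlV⟩ := mem_nhds_iff.1 hU
  obtain ⟨y, hyV, hy⟩ := mem_closure_iff.1 hl V hV hlV
  exact hy U (mem_of_superset (hV.mem_nhds hyV) hVU)

variable {φ : Set ℕ → ℝ≥0∞}

theorem HasNormGap.clusterPoints_subset_limitPoints [FirstCountableTopology X]
    (hφ : IsLSCSubmeasure φ) (h : HasNormGap φ) :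
    clusterPoints (idealOf φ) x ⊆ limitPoints (idealOf φ) x := by
  intro l hl
  obtain ⟨δ, hδ, hδtop, hgap⟩ := h
  have hlt : δ / 2 < δ := ENNReal.half_lt_self hδ.ne' hδtop
  obtain ⟨U, hU⟩ := (𝓝 l).exists_antitone_basis
  let V : ℕ → Set ℕ := fun k => {m | x m ∈ U k}
  have hV : ∀ k, δ ≤ subNorm φ (V k) := fun k =>
    not_lt.1 fun hk => hl (U k) (hU.mem k) (hgap _ hk)
  have hVanti : Antitone V := fun i j hij m hm => hU.antitone hij hm
  -- Every tail of `V k` has submeasure at least `δ`, so by lower semicontinuity a finite block of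
  -- it already exceeds `δ / 2`.
  have hnext : ∀ k m, ∃ m', m < m' ∧ δ / 2 < φ ((V k \ Iio m) ∩ Iio m') := fun k m =>
    ((eventually_gt_atTop m).and ((hφ.lsc _).eventually_const_lt
      (hlt.trans_le ((hV k).trans (iInf_le _ m))))).exists
  choose g hg hgφ using hnext
  let s : ℕ → ℕ := fun n => Nat.rec 0 g n
  have hs : ∀ k, s (k + 1) = g k (s k) := fun _ => rfl
  have hsmono : StrictMono s := strictMono_nat_of_lt_succ fun k => hg k _
  let P : ℕ → Set ℕ := fun k => (V k \ Iio (s k)) ∩ Iio (s (k + 1))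
  refine (mem_limitPoints_iff (mem_idealOf_of_finite hφ)).2 ⟨⋃ k, P k, fun hmem => ?_,
    fun W hW => ?_⟩
  · refine (ENNReal.half_pos hδ.ne').not_ge (le_of_le_of_eq (le_iInf fun n => ?_) hmem)
    -- Since `n ≤ s n`, block `n` survives the removal of `Iio n`.
    refine (hgφ n (s n)).le.trans (hφ.mono fun m hm => ⟨mem_iUnion.2 ⟨n, hm⟩, ?_⟩)
    exact fun hmn => hm.1.2 (lt_of_lt_of_le hmn (hsmono.id_le n))
  · obtain ⟨k, hk⟩ := hU.mem_iff.1 hW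
    refine (finite_Iio (s k)).subset ?_
    rintro m ⟨hm, hmW⟩
    obtain ⟨i, hi⟩ := mem_iUnion.1 hm
    have hik : i < k := not_le.1 fun hki => hmW (hk (hVanti hki hi.1.1))
    exact lt_of_lt_of_le hi.2 (hsmono.monotone hik)

/-- Let `x` equal `u n` on `A n`. Each `u n` is a limit point, but a set along which `x` tends to
`l` meets every piece finitely, as `u n ≠ l`, and so is null. -/
theorem IsVanishingPartition.exists_not_isClosed_limitPoints [T1Space X]
    (hX : HasNontrivialConvergentSeq X) (hφ : IsLSCSubmeasure φ) {A : ℕ → Set ℕ}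
    (hA : IsVanishingPartition φ A) :
    ∃ x : ℕ → X, ¬ IsClosed (limitPoints (idealOf φ) x) := by
  obtain ⟨u, l, hu, hul⟩ := hX
  obtain ⟨p, hp⟩ := hA.exists_index
  have hfin := mem_idealOf_of_finite hφ
  refine ⟨fun m => u (p m), fun hclosed => ?_⟩
  have hl : l ∈ limitPoints (idealOf φ) fun m => u (p m) := by
    refine hclosed.mem_of_tendsto hu (Eventually.of_forall fun n => ?_)
    refine (mem_limitPoints_iff hfin).2 ⟨A n, (hA.pos n).ne', fun U hU => ?_⟩
    convert finite_empty
    refine eq_empty_of_forall_notMem fun m hm => hm.2 ?_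
    rw [(hp m n).1 hm.1]
    exact mem_of_mem_nhds hU
  obtain ⟨S, hSI, hS⟩ := (mem_limitPoints_iff hfin).1 hl
  refine hSI (hA.subNorm_eq_zero hφ fun n => ?_)
  refine (hS {u n}ᶜ (isOpen_compl_singleton.mem_nhds (hul n).symm)).subset fun m hm => ⟨hm.1, ?_⟩
  simp [(hp m n).1 hm.2]

end Points

end IdealLimit

theorem theorem2p4 (X : Type*) [TopologicalSpace X] [T2Space X] [FirstCountableTopology X]
    (hX : IdealLimit.HasNontrivialConvergentSeq X)
    (φ : Set ℕ → ℝ≥0∞) (hφ : IdealLimit.IsLSCSubmeasure φ) (hfin : φ univ < ∞)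
    (hI : IdealLimit.IsAnalyticPIdeal (IdealLimit.idealOf φ)) :
    List.TFAE [
      IdealLimit.IsFSigma (IdealLimit.inCantor (IdealLimit.idealOf φ)),
      ∀ x : ℕ → X, IdealLimit.limitPoints (IdealLimit.idealOf φ) x =
        IdealLimit.clusterPoints (IdealLimit.idealOf φ) x,
      ∀ x : ℕ → X, IsClosed (IdealLimit.limitPoints (IdealLimit.idealOf φ) x),
      ¬ ∃ A : ℕ → Set ℕ, IdealLimit.IsVanishingPartition φ A] := by
  have gap : (¬ ∃ A : ℕ → Set ℕ, IdealLimit.IsVanishingPartition φ A) →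
      IdealLimit.HasNormGap φ := fun h => by
    by_contra hgap
    exact h (IdealLimit.exists_isVanishingPartition hφ hgap)
  tfae_have 1 → 4 := fun h ⟨A, hA⟩ =>
    IdealLimit.not_isVanishingPartition_of_isFSigma hφ h A hA
  tfae_have 4 → 1 := fun h => (gap h).isFSigma hφ
  tfae_have 4 → 2 := fun h x =>
    (IdealLimit.limitPoints_subset_clusterPoints hI.isIdeal).antisymm
      ((gap h).clusterPoints_subset_limitPoints hφ)
  tfae_have 2 → 3 := fun h x => by
    rw [h x]
    exact IdealLimit.isClosed_clusterPoints
  tfae_have 3 → 4 := fun h ⟨A, hA⟩ => by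
    obtain ⟨x, hx⟩ := hA.exists_not_isClosed_limitPoints hX hφ
    exact hx (h x)
  tfae_finish
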